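/- Let $B$ be a unital $C^*$-algebra and let $\mathcal H$ be a complex Hilbert space. Let $\mathrm{Ball}(B)$ be the set of all square matrices $X\in M_n(B)$, $n\ge 1$, with $\|X\|<1$. A graded function $f$ on $\mathrm{Ball}(B)$ assigns to each $X\in \mathrm{Ball}(B)\cap M_n(B)$ a matrix $f(X)\in M_n(B(\mathcal H))=B(\mathcal H^n)$. The space of all graded functions carries the pointwise weak operator topology, the topology generated by the functions $f\mapsto\langle f(X)h,k\rangle$, where $X\in\mathrm{Ball}(B)\cap M_n(B)$ and $h,k\in\mathcal H^n$. A graded function $f$ is a regular free Herglotz function if it is free ($\Gamma X=Y\Gamma$ implies $\Gamma f(X)=f(Y)\Gamma$ for rectangular scalar matrices $\Gamma$), $\operatorname{Re} f(X)\ge 0$ for all $X$, and $f(0)=I$. It is representable if there are a Hilbert space $\widehat{\mathcal H}\supseteq\mathcal H$, a unitary $U\in B(\widehat{\mathcal H})$ and a unital $*$-representation $\alpha:B\to B(\widehat{\mathcal H})$ (all allowed to depend on $f$) such that, for all $n$ and all $X\in\mathrm{Ball}(B)\cap M_n(B)$, $$f(X)=(R\otimes 1_n)\Big[\big(I+(U\otimes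 I_n)(\alpha\otimes 1_n)(X)\big)\big(I-(U\otimes I_n)(\alpha\otimes 1_n)(X)\big)^{-1}\Big],\qquad(*)$$ where $R:B(\widehat{\mathcal H})\to B(\mathcal H)$ is the compression to $\mathcal H$. Let $\widehat\chi_B^{\mathcal H}$ be the set of representable regular free Herglotz functions. Let $\mathcal A_B$ be the unital $*$-algebra generated by $B$ (with the same unit) and one unitary $u$ with no other relations, normed by its largest $C^*$-seminorm. An operator-valued state on $\mathcal A_B$ is a linear map $\phi:\mathcal A_B\to B(\mathcal H)$ with $\phi(1)=1$ such that, for all $n$ and all $a_1,\dots,a_n,b\in\mathcal A_B$, the operator matrices $[\phi(a_i^*a_j)]_{i,j}$ and $[\phi(a_i^*(\|b^*b\|-b^*b)a_j)]_{i,j}$ are positive. Let $\Phi$ be the set of operator-valued states on $\mathcal A_B$, with the pointwise weak operator topology. For $\phi\in\Phi$ let $\mathcal H_\phi$ be the Hilbert space completion of $\mathcal A_B\otimes\mathcal H$, modulo null vectors, for $\langle a_1\otimes h_1,a_2\otimes h_2\rangle=\langle\phi(a_2^*a_1)h_1,h_2\rangle$. It contains $\mathcal H$ via $h\mapsto 1\otimes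 h$, and $\mathcal A_B$ acts on it by $\pi_\phi(a)(x\otimes h)=ax\otimes h$. Let $g_\phi$ be the graded function given by the right-hand side of $(*)$ with $\widehat{\mathcal H}=\mathcal H_\phi$, $U=\pi_\phi(u)$ and $\alpha=\pi_\phi|_B$. Then $\Phi$ is compact, the map $\phi\mapsto g_\phi$ is continuous on $\Phi$, and its image is exactly $\widehat\chi_B^{\mathcal H}$. Consequently $\widehat\chi_B^{\mathcal H}$ is compact, and it is closed in the space of all graded functions on $\mathrm{Ball}(B)$, in the pointwise weak operator topology. -/

import Mathlib

universe u v

namespace FreeHerglotz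

open scoped ComplexOrder TensorProduct

set_option linter.unusedSectionVars false

/-! ### The `*`-algebra obtained from `B` by freely adjoining a unitary -/

section FreeUnitary

variable (B : Type u) [CStarAlgebra B]

/-- The monoid of formal words in elements of `B` and integer powers of a letter `u`, where
adjacent elements of `B` (and adjacent powers of `u`) are multiplied out. -/
abbrev WordMonoid : Type u := Monoid.Coprod B (Multiplicative ℤ)

/-- The reversal of words, as a homomorphism to the opposite monoid:
`b` goes to `star b` and `u ^ k` goes to `u ^ (-k)`. -/
def wordStarHom : WordMonoid B →* (WordMonoid B)ᵐᵒᵖ :=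
  Monoid.Coprod.lift
    { toFun := fun b => MulOpposite.op (Monoid.Coprod.inl (star b))
      map_one' := by simp
      map_mul' := fun a b => by simp [← MulOpposite.op_mul] }
    { toFun := fun k => MulOpposite.op (Monoid.Coprod.inr k⁻¹)
      map_one' := by simp
      map_mul' := fun a b => by rw [← MulOpposite.op_mul, ← map_mul, mul_inv_rev] }

@[simp] lemma wordStarHom_inl (b : B) :
    wordStarHom B (Monoid.Coprod.inl b) = MulOpposite.op (Monoid.Coprod.inl (star b)) := rfl

@[simp] lemma wordStarHom_inr (k : Multiplicative ℤ) :
    wordStarHom B (Monoid.Coprod.inr k) = MulOpposite.op (Monoid.Coprod.inr k⁻¹) := rfl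

lemma wordStarHom_invol (w : WordMonoid B) :
    (wordStarHom B (wordStarHom B w).unop).unop = w := by
  have h : (MonoidHom.comp (MulEquiv.opOp (WordMonoid B)).symm.toMonoidHom
      ((wordStarHom B).op.comp (wordStarHom B))) = MonoidHom.id _ := by
    apply Monoid.Coprod.hom_ext
    · ext b
      simp
    · apply MonoidHom.ext
      intro k
      simp
  exact DFunLike.congr_fun h w

/-- The conjugate-linear extension of word reversal to formal linear combinations of words. -/
noncomputable def wordAlgStarHom :
    MonoidAlgebra ℂ (WordMonoid B) →+* (MonoidAlgebra ℂ (WordMonoid B))ᵐᵒᵖ :=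
  MonoidAlgebra.liftNCRingHom
    (((algebraMap ℂ (MonoidAlgebra ℂ (WordMonoid B))).toOpposite
      (fun x _ => Algebra.commute_algebraMap_left x _)).comp (starRingEnd ℂ))
    ((MonoidAlgebra.of ℂ (WordMonoid B)).op.comp (wordStarHom B))
    (fun x _ => show Commute _ _ from
      MulOpposite.unop_injective (Algebra.commutes (star x) _).symm)

lemma wordAlgStarHom_single (w : WordMonoid B) (c : ℂ) :
    wordAlgStarHom B (MonoidAlgebra.single w c) =
      MulOpposite.op (MonoidAlgebra.single (wordStarHom B w).unop (star c)) := by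
  rw [wordAlgStarHom, MonoidAlgebra.liftNCRingHom_single]
  apply MulOpposite.unop_injective
  simp

/-- The involution on formal linear combinations of words:
`(∑ c_i w_i)* = ∑ (conj c_i) w_i*`. -/
noncomputable instance wordAlgStarRing : StarRing (MonoidAlgebra ℂ (WordMonoid B)) where
  star x := (wordAlgStarHom B x).unop
  star_involutive x := by
    change (wordAlgStarHom B (wordAlgStarHom B x).unop).unop = x
    induction x using MonoidAlgebra.induction_linear with
    | zero => simp
    | add f g hf hg => simp [hf, hg]
    | single w c => simp [wordAlgStarHom_single, wordStarHom_invol]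
  star_mul _ _ := by
    rw [map_mul, MulOpposite.unop_mul]
  star_add _ _ := by
    rw [map_add, MulOpposite.unop_add]

lemma star_single (w : WordMonoid B) (c : ℂ) :
    star (MonoidAlgebra.single w c) =
      MonoidAlgebra.single (wordStarHom B w).unop (star c) := by
  change (wordAlgStarHom B _).unop = _
  rw [wordAlgStarHom_single, MulOpposite.unop_op]

/-- The remaining relations: the one-letter words `b` depend linearly on `b ∈ B`.
(Products in `B`, the unit and `u u* = u* u = 1` are taken care of by the monoid of words.) -/
inductive WordRel : MonoidAlgebra ℂ (WordMonoid B) → MonoidAlgebra ℂ (WordMonoid B) → Prop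
  | add (a b : B) : WordRel
      (MonoidAlgebra.single (Monoid.Coprod.inl (a + b)) 1)
      (MonoidAlgebra.single (Monoid.Coprod.inl a) 1 +
        MonoidAlgebra.single (Monoid.Coprod.inl b) 1)
  | smul (c : ℂ) (a : B) : WordRel
      (MonoidAlgebra.single (Monoid.Coprod.inl (c • a)) 1)
      (MonoidAlgebra.single (Monoid.Coprod.inl a) c)

lemma WordRel.star_rel (x y : MonoidAlgebra ℂ (WordMonoid B)) (h : WordRel B x y) :
    WordRel B (star x) (star y) := by
  cases h with
  | add a b => simpa [star_single] using WordRel.add (star a) (star b)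
  | smul c a => simpa [star_single] using WordRel.smul (star c) (star a)

/-- The `*`-algebra generated by the `*`-algebra `B` (with the same unit) and one additional
unitary element `u`, with no other relations. -/
def FreeUnitary : Type u := RingQuot (WordRel B)

namespace FreeUnitary

noncomputable instance : Ring (FreeUnitary B) := inferInstanceAs (Ring (RingQuot (WordRel B)))

noncomputable instance : Algebra ℂ (FreeUnitary B) :=
  inferInstanceAs (Algebra ℂ (RingQuot (WordRel B)))

noncomputable instance : StarRing (FreeUnitary B) :=
  RingQuot.starRing (WordRel B) (WordRel.star_rel B)

/-- The quotient map from formal linear combinations of words. -/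
noncomputable def mk : MonoidAlgebra ℂ (WordMonoid B) →ₐ[ℂ] FreeUnitary B :=
  RingQuot.mkAlgHom ℂ (WordRel B)

lemma mk_surjective : Function.Surjective (mk B) := RingQuot.mkAlgHom_surjective ℂ (WordRel B)

lemma mk_rel {x y : MonoidAlgebra ℂ (WordMonoid B)} (h : WordRel B x y) : mk B x = mk B y :=
  RingQuot.mkAlgHom_rel ℂ h

lemma mk_star (x : MonoidAlgebra ℂ (WordMonoid B)) : mk B (star x) = star (mk B x) := by
  simp only [mk, RingQuot.mkAlgHom_def, RingQuot.mkRingHom_def]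
  rfl

instance : StarModule ℂ (FreeUnitary B) where
  star_smul c x := by
    obtain ⟨x, rfl⟩ := mk_surjective B x
    have h : star (c • x) = star c • star x := by
      rw [Algebra.smul_def, Algebra.smul_def, star_mul, Algebra.commutes]
      congr 1
      simp only [MonoidAlgebra.coe_algebraMap, Function.comp_apply, star_single]
      simp
    rw [← map_smul, ← mk_star, h, map_smul, mk_star]

/-- The canonical unital `*`-homomorphism from `B`. -/
noncomputable def of : B →⋆ₐ[ℂ] FreeUnitary B where
  toFun b := mk B (MonoidAlgebra.single (Monoid.Coprod.inl b) 1)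
  map_one' := by
    rw [map_one]
    exact map_one (mk B)
  map_mul' a b := by
    rw [← map_mul (mk B), MonoidAlgebra.single_mul_single, one_mul, ← map_mul]
  map_zero' := by
    have h := mk_rel B (WordRel.smul (B := B) 0 0)
    simpa using h
  map_add' a b := by
    rw [← map_add]
    exact mk_rel B (WordRel.add a b)
  commutes' c := by
    have h := mk_rel B (WordRel.smul (B := B) c 1)
    rw [← Algebra.algebraMap_eq_smul_one] at h
    rw [h, map_one, ← AlgHom.commutes (mk B)]
    rfl
  map_star' b := by
    rw [← mk_star, star_single]
    simp

/-- The additional unitary element. -/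
noncomputable def gen : FreeUnitary B :=
  mk B (MonoidAlgebra.single (Monoid.Coprod.inr (Multiplicative.ofAdd 1)) 1)

lemma gen_mem_unitary : gen B ∈ unitary (FreeUnitary B) := by
  have h1 : mk B (MonoidAlgebra.single 1 1) = 1 := map_one (mk B)
  constructor
  · rw [gen, ← mk_star, star_single, ← map_mul, MonoidAlgebra.single_mul_single]
    simp [← map_mul, h1]
  · rw [gen, ← mk_star, star_single, ← map_mul, MonoidAlgebra.single_mul_single]
    simp [← map_mul, h1]

end FreeUnitary

/-- `C*`-seminorms on a complex `*`-algebra. -/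
structure IsCStarSeminorm {A : Type*} [Ring A] [StarRing A] [Algebra ℂ A]
    (p : Seminorm ℂ A) : Prop where
  mul_le : ∀ a b, p (a * b) ≤ p a * p b
  star_mul_self : ∀ a, p (star a * a) = p a ^ 2

/-- The universal pre-`C*`-norm: the largest `C*`-seminorm.  Its completion is the universal
`C*`-algebra generated by `B` and a unitary. -/
noncomputable instance FreeUnitary.instNorm : Norm (FreeUnitary B) where
  norm x := sSup {r : ℝ | ∃ p : Seminorm ℂ (FreeUnitary B), IsCStarSeminorm p ∧ p x = r}

end FreeUnitary

/-! ### Operator matrices and operator-valued states -/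

section States

variable {H : Type v} [NormedAddCommGroup H] [InnerProductSpace ℂ H]

/-- The inner product of `H`, linear in the second variable. -/
local notation "⟪" x "," y "⟫" => @inner ℂ _ InnerProductSpace.toInner x y

/-- `⟨M h, k⟩` for an operator matrix `M` acting on `Hⁿ = H ⊗ ℂⁿ`
(the pairing being linear in `h` and conjugate-linear in `k`). -/
noncomputable def matForm {n : ℕ} (M : Matrix (Fin n) (Fin n) (H →L[ℂ] H)) (h k : Fin n → H) : ℂ :=
  ∑ i, ∑ j, ⟪k i, M i j (h j)⟫

/-- Positivity of an operator matrix, as an operator on `Hⁿ`: all the numbers `⟨M h, h⟩` are real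
and nonnegative. -/
def MatNonneg {n : ℕ} (M : Matrix (Fin n) (Fin n) (H →L[ℂ] H)) : Prop :=
  ∀ h : Fin n → H, 0 ≤ matForm M h h

/-- Operator-valued states on a unital `*`-algebra `A` equipped with a norm. -/
structure OperatorState (A : Type u) [Ring A] [StarRing A] [Algebra ℂ A] [Norm A]
    (H : Type v) [NormedAddCommGroup H] [InnerProductSpace ℂ H] where
  toFun : A →ₗ[ℂ] (H →L[ℂ] H)
  unital : toFun 1 = 1
  completely_positive : ∀ (n : ℕ) (a : Fin n → A),
    MatNonneg (Matrix.of fun i j => toFun (star (a i) * a j))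
  completely_bounded : ∀ (n : ℕ) (a : Fin n → A) (b : A),
    MatNonneg (Matrix.of fun i j =>
      toFun (star (a i) * (algebraMap ℂ A (‖star b * b‖ : ℝ) - star b * b) * a j))

namespace OperatorState

variable {A : Type u} [Ring A] [StarRing A] [Algebra ℂ A] [StarModule ℂ A] [Norm A]

/-- The pointwise weak operator topology on operator-valued states: the topology generated by the
functions `φ ↦ ⟨φ(a) h, k⟩`. -/
noncomputable instance instTopologicalSpace : TopologicalSpace (OperatorState A H) :=
  TopologicalSpace.induced
    (fun φ => fun p : A × H × H => ⟪p.2.2, φ.toFun p.1 p.2.1⟫)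
    inferInstance

/-! ### The GNS construction -/

/-- The functional `a₂ ⊗ h₂ ↦ ⟨φ(a₁* a₂) h₂, h₁⟩`. -/
noncomputable def gnsFunctional (φ : OperatorState A H) (a₁ : A) (h₁ : H) : A ⊗[ℂ] H →ₗ[ℂ] ℂ :=
  TensorProduct.lift
    (LinearMap.mk₂ ℂ (fun a₂ h₂ => ⟪h₁, φ.toFun (star a₁ * a₂) h₂⟫)
      (fun a b h => by simp [mul_add, inner_add_right])
      (fun c a h => by simp [inner_smul_right])
      (fun a h k => by simp [inner_add_right])
      (fun c a h => by simp [inner_smul_right]))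

/-- The sesquilinear form on `A ⊗ H`, conjugate-linear in the first variable, with
`gnsForm φ (a₁ ⊗ h₁) (a₂ ⊗ h₂) = ⟨φ(a₁* a₂) h₂, h₁⟩`. -/
noncomputable def gnsForm (φ : OperatorState A H) : A ⊗[ℂ] H →ₗ⋆[ℂ] A ⊗[ℂ] H →ₗ[ℂ] ℂ :=
  TensorProduct.lift
    (LinearMap.mk₂'ₛₗ (starRingEnd ℂ) (starRingEnd ℂ) (gnsFunctional φ)
      (fun a b h => by
        ext a' h'
        simp [gnsFunctional, add_mul, inner_add_right])
      (fun c a h => by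
        ext a' h'
        simp [gnsFunctional, inner_smul_right])
      (fun a h k => by
        ext a' h'
        simp [gnsFunctional, inner_add_left])
      (fun c a h => by
        ext a' h'
        simp [gnsFunctional, inner_smul_left]))

lemma gnsForm_tmul (φ : OperatorState A H) (a₁ a₂ : A) (h₁ h₂ : H) :
    gnsForm φ (a₁ ⊗ₜ h₁) (a₂ ⊗ₜ h₂) = ⟪h₁, φ.toFun (star a₁ * a₂) h₂⟫ := by
  simp [gnsForm, gnsFunctional]

lemma exists_sum_tmul (x : A ⊗[ℂ] H) :
    ∃ (n : ℕ) (a : Fin n → A) (h : Fin n → H), x = ∑ i, a i ⊗ₜ[ℂ] h i := by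
  obtain ⟨S, rfl⟩ := TensorProduct.exists_finset x
  refine ⟨S.card, fun i => (S.equivFin.symm i).1.1, fun i => (S.equivFin.symm i).1.2, ?_⟩
  rw [← Finset.sum_coe_sort S]
  exact (Equiv.sum_comp S.equivFin.symm (fun i : S => i.1.1 ⊗ₜ[ℂ] i.1.2)).symm

lemma gnsForm_sum (φ : OperatorState A H) (c : A) {n : ℕ} (a : Fin n → A) (h : Fin n → H) :
    gnsForm φ (∑ i, a i ⊗ₜ h i) (∑ i, (c * a i) ⊗ₜ h i) =
      matForm (Matrix.of fun i j => φ.toFun (star (a i) * c * a j)) h h := by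
  simp only [matForm, gnsForm_tmul, mul_assoc, map_sum, LinearMap.sum_apply, Matrix.of_apply]
  exact Finset.sum_comm

lemma gnsForm_nonneg (φ : OperatorState A H) (x : A ⊗[ℂ] H) : 0 ≤ gnsForm φ x x := by
  obtain ⟨n, a, h, rfl⟩ := exists_sum_tmul x
  have h1 := gnsForm_sum φ 1 a h
  simp only [one_mul, mul_one] at h1
  rw [h1]
  exact φ.completely_positive n a h

/-- A form that is positive on the diagonal is Hermitian. -/
lemma gnsForm_symm (φ : OperatorState A H) (x y : A ⊗[ℂ] H) :
    star (gnsForm φ y x) = gnsForm φ x y := by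
  have hx := (Complex.nonneg_iff.mp (gnsForm_nonneg φ x)).2
  have hy := (Complex.nonneg_iff.mp (gnsForm_nonneg φ y)).2
  have h1 := (Complex.nonneg_iff.mp (gnsForm_nonneg φ (x + y))).2
  have h2 := (Complex.nonneg_iff.mp (gnsForm_nonneg φ (x + Complex.I • y))).2
  simp only [map_add, LinearMap.add_apply, LinearMap.map_smulₛₗ, LinearMap.smul_apply,
    RingHom.id_apply, smul_eq_mul, Complex.add_im, Complex.mul_im, Complex.mul_re, Complex.add_re,
    Complex.I_re, Complex.I_im, Complex.conj_I, Complex.neg_re, Complex.neg_im] at h1 h2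
  apply Complex.ext
  · simp only [Complex.star_def, Complex.conj_re]
    linarith
  · simp only [Complex.star_def, Complex.conj_im]
    linarith

set_option linter.unusedVariables false in
/-- The space `A ⊗ H`, with the semi-inner product defined by `φ`. -/
def PreGNS (φ : OperatorState A H) : Type (max u v) := A ⊗[ℂ] H

noncomputable instance (φ : OperatorState A H) : AddCommGroup φ.PreGNS :=
  inferInstanceAs (AddCommGroup (A ⊗[ℂ] H))

noncomputable instance (φ : OperatorState A H) : Module ℂ φ.PreGNS :=
  inferInstanceAs (Module ℂ (A ⊗[ℂ] H))

/-- The identity map from `A ⊗ H` to `φ.PreGNS`. -/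
noncomputable def toPreGNS (φ : OperatorState A H) : A ⊗[ℂ] H ≃ₗ[ℂ] φ.PreGNS :=
  LinearEquiv.refl ℂ _

/-- The semi-inner product on `A ⊗ H`. -/
noncomputable abbrev preGNSCore (φ : OperatorState A H) :
    PreInnerProductSpace.Core ℂ φ.PreGNS where
  inner x y := gnsForm φ (φ.toPreGNS.symm x) (φ.toPreGNS.symm y)
  conj_inner_symm x y := gnsForm_symm φ _ _
  re_inner_nonneg x := (Complex.nonneg_iff.mp (gnsForm_nonneg φ _)).1
  add_left x y z := by simp
  smul_left x y c := by simp

noncomputable instance (φ : OperatorState A H) : SeminormedAddCommGroup φ.PreGNS :=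
  InnerProductSpace.Core.toSeminormedAddCommGroup (c := φ.preGNSCore)

noncomputable instance (φ : OperatorState A H) : InnerProductSpace ℂ φ.PreGNS :=
  InnerProductSpace.ofCore φ.preGNSCore

lemma preGNS_inner (φ : OperatorState A H) (x y : φ.PreGNS) :
    ⟪x, y⟫ = gnsForm φ (φ.toPreGNS.symm x) (φ.toPreGNS.symm y) := rfl

lemma preGNS_norm_sq (φ : OperatorState A H) (x : φ.PreGNS) :
    ‖x‖ ^ 2 = (gnsForm φ (φ.toPreGNS.symm x) (φ.toPreGNS.symm x)).re := by
  rw [← preGNS_inner, inner_self_eq_norm_sq_to_K]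
  norm_cast

/-- The Hilbert space of the GNS construction: the completion of `A ⊗ H` modulo null vectors. -/
abbrev GNS (φ : OperatorState A H) : Type (max u v) := UniformSpace.Completion φ.PreGNS

/-- Left multiplication `x ⊗ h ↦ a x ⊗ h`. -/
noncomputable def leftMul (a : A) : A ⊗[ℂ] H →ₗ[ℂ] A ⊗[ℂ] H :=
  LinearMap.rTensor H (LinearMap.mulLeft ℂ a)

@[simp] lemma leftMul_tmul (a x : A) (h : H) :
    leftMul a (x ⊗ₜ[ℂ] h) = (a * x) ⊗ₜ[ℂ] h := rfl

lemma gnsForm_leftMul (φ : OperatorState A H) (a : A) (x y : A ⊗[ℂ] H) :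
    gnsForm φ (leftMul a x) y = gnsForm φ x (leftMul (star a) y) := by
  induction x with
  | zero => simp
  | add x x' hx hx' => simp [hx, hx']
  | tmul x h =>
    induction y with
    | zero => simp
    | add y y' hy hy' => rw [map_add, map_add, map_add, hy, hy']
    | tmul y k => simp [gnsForm_tmul, mul_assoc]

lemma leftMul_mul (a b : A) (x : A ⊗[ℂ] H) : leftMul (a * b) x = leftMul a (leftMul b x) := by
  induction x with
  | zero => simp
  | add x x' hx hx' => simp [hx, hx']
  | tmul x h => simp [mul_assoc]

lemma leftMul_add (a b : A) (x : A ⊗[ℂ] H) : leftMul (a + b) x = leftMul a x + leftMul b x := by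
  induction x with
  | zero => simp
  | add x x' hx hx' => rw [map_add, map_add, map_add, hx, hx']; abel
  | tmul x h => simp [add_mul, TensorProduct.add_tmul]

lemma leftMul_smul_one (c : ℂ) (x : A ⊗[ℂ] H) : leftMul (c • (1 : A)) x = c • x := by
  induction x with
  | zero => simp
  | add x x' hx hx' => rw [map_add, hx, hx', smul_add]
  | tmul x h => rw [leftMul_tmul, smul_mul_assoc, one_mul, TensorProduct.smul_tmul']

lemma leftMul_bound (φ : OperatorState A H) (b : A) (x : A ⊗[ℂ] H) :
    (gnsForm φ (leftMul b x) (leftMul b x)).re ≤ ‖star b * b‖ * (gnsForm φ x x).re := by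
  rw [gnsForm_leftMul, ← leftMul_mul]
  obtain ⟨n, a, h, rfl⟩ := exists_sum_tmul x
  have h0 := φ.completely_bounded n a b h
  rw [← gnsForm_sum] at h0
  have h1 : ∑ i, ((algebraMap ℂ A (‖star b * b‖ : ℝ) - star b * b) * a i) ⊗ₜ[ℂ] h i =
      ((‖star b * b‖ : ℝ) : ℂ) • (∑ i, a i ⊗ₜ[ℂ] h i) -
        leftMul (star b * b) (∑ i, a i ⊗ₜ[ℂ] h i) := by
    simp only [sub_mul, TensorProduct.sub_tmul, Finset.sum_sub_distrib, map_sum, leftMul_tmul,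
      Finset.smul_sum, ← Algebra.smul_def, TensorProduct.smul_tmul']
  rw [h1, map_sub, map_smul] at h0
  have h2 := (Complex.nonneg_iff.mp h0).1
  rw [Complex.sub_re, smul_eq_mul, Complex.re_ofReal_mul] at h2
  linarith

/-- Left multiplication as a bounded operator for the seminorm defined by `φ`. -/
noncomputable def preGNSMul (φ : OperatorState A H) (a : A) : φ.PreGNS →L[ℂ] φ.PreGNS :=
  LinearMap.mkContinuous
    (φ.toPreGNS.toLinearMap ∘ₗ leftMul a ∘ₗ φ.toPreGNS.symm.toLinearMap)
    (Real.sqrt ‖star a * a‖) (fun x => by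
      refine abs_le_of_sq_le_sq' ?_ (by positivity) |>.2
      rw [mul_pow, preGNS_norm_sq, preGNS_norm_sq]
      refine (leftMul_bound φ a (φ.toPreGNS.symm x)).trans ?_
      refine mul_le_mul_of_nonneg_right ?_ (Complex.nonneg_iff.mp (gnsForm_nonneg φ _)).1
      rcases le_total 0 ‖star a * a‖ with h | h
      · rw [Real.sq_sqrt h]
      · exact h.trans (sq_nonneg _))

lemma preGNSMul_apply (φ : OperatorState A H) (a : A) (x : φ.PreGNS) :
    φ.preGNSMul a x = φ.toPreGNS (leftMul a (φ.toPreGNS.symm x)) := rfl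

/-- The GNS representation `π_φ(a) : x ⊗ h ↦ a x ⊗ h`. -/
noncomputable def gnsRep (φ : OperatorState A H) : A →⋆ₐ[ℂ] (φ.GNS →L[ℂ] φ.GNS) where
  toFun a := (φ.preGNSMul a).completion
  map_one' := by
    ext x
    induction x using UniformSpace.Completion.induction_on with
    | hp => apply isClosed_eq <;> fun_prop
    | ih x => simp [preGNSMul_apply, leftMul]
  map_mul' a b := by
    ext x
    induction x using UniformSpace.Completion.induction_on with
    | hp => apply isClosed_eq <;> fun_prop
    | ih x => simp [preGNSMul_apply, leftMul_mul]
  map_zero' := by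
    ext x
    induction x using UniformSpace.Completion.induction_on with
    | hp => apply isClosed_eq <;> fun_prop
    | ih x => simp [preGNSMul_apply, leftMul, UniformSpace.Completion.coe_zero]
  map_add' a b := by
    ext x
    induction x using UniformSpace.Completion.induction_on with
    | hp => apply isClosed_eq <;> fun_prop
    | ih x => simp [preGNSMul_apply, leftMul_add, UniformSpace.Completion.coe_add]
  commutes' c := by
    ext x
    induction x using UniformSpace.Completion.induction_on with
    | hp => apply isClosed_eq <;> fun_prop
    | ih x =>
      simp [preGNSMul_apply, leftMul_smul_one, Algebra.algebraMap_eq_smul_one]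
  map_star' a := by
    refine (ContinuousLinearMap.eq_adjoint_iff (φ.preGNSMul (star a)).completion
      (φ.preGNSMul a).completion).mpr ?_
    intro x y
    induction x, y using UniformSpace.Completion.induction_on₂ with
    | hp => apply isClosed_eq <;> fun_prop
    | ih x y => simp [preGNSMul_apply, preGNS_inner, gnsForm_leftMul]

/-- The embedding `h ↦ 1 ⊗ h` of `H` into the GNS space. -/
noncomputable def gnsEmbed (φ : OperatorState A H) : H →ₗᵢ[ℂ] φ.GNS where
  toFun h := ((φ.toPreGNS (1 ⊗ₜ h) : φ.PreGNS) : φ.GNS)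
  map_add' h k := by
    rw [TensorProduct.tmul_add, map_add, UniformSpace.Completion.coe_add]
  map_smul' c h := by
    rw [TensorProduct.tmul_smul, map_smul, UniformSpace.Completion.coe_smul, RingHom.id_apply]
  norm_map' h := by
    change ‖((φ.toPreGNS (1 ⊗ₜ h) : φ.PreGNS) : φ.GNS)‖ = ‖h‖
    rw [UniformSpace.Completion.norm_coe, ← sq_eq_sq₀ (norm_nonneg _) (norm_nonneg _),
      preGNS_norm_sq]
    simp [gnsForm_tmul, φ.unital, inner_self_eq_norm_sq_to_K]
    norm_cast

end OperatorState

end States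

/-! ### Free Herglotz functions -/

section Functions

/-- The `n × n` matrices over `B` of norm `< 1`, for the `C*`-norm on matrices. -/
def MatBall (B : Type u) [CStarAlgebra B] [PartialOrder B] [StarOrderedRing B] (n : ℕ+) :
    Set (Matrix (Fin n) (Fin n) B) :=
  {X | ‖CStarMatrix.ofMatrix X‖ < 1}

/-- Graded functions from the ball over `B` to the square matrices over `B(H)`. -/
def GradedFun (B : Type u) [CStarAlgebra B] [PartialOrder B] [StarOrderedRing B]
    (H : Type v) [NormedAddCommGroup H] [InnerProductSpace ℂ H] : Type (max u v) :=
  ∀ n : ℕ+, MatBall B n → Matrix (Fin n) (Fin n) (H →L[ℂ] H)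

variable {B : Type u} [CStarAlgebra B] [PartialOrder B] [StarOrderedRing B]
variable {H : Type v} [NormedAddCommGroup H] [InnerProductSpace ℂ H] [CompleteSpace H]

/-- The pointwise weak operator topology: the topology generated by the functions
`f ↦ ⟨f(X) h, k⟩`, where `X` is an `n × n` matrix in the ball and `h, k ∈ Hⁿ`. -/
noncomputable instance GradedFun.instTopologicalSpace : TopologicalSpace (GradedFun B H) :=
  TopologicalSpace.induced
    (fun f => fun p : (Σ n : ℕ+, MatBall B n × (Fin n → H) × (Fin n → H)) =>
      matForm (f p.1 p.2.1) p.2.2.1 p.2.2.2)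
    inferInstance

/-- Free functions: graded functions respecting intertwining by rectangular scalar matrices. -/
def IsFree (f : GradedFun B H) : Prop :=
  ∀ (n m : ℕ+) (Γ : Matrix (Fin m) (Fin n) ℂ) (X : MatBall B n) (Y : MatBall B m),
    Γ.map (algebraMap ℂ B) * X.1 = Y.1 * Γ.map (algebraMap ℂ B) →
    Γ.map (algebraMap ℂ (H →L[ℂ] H)) * f n X = f m Y * Γ.map (algebraMap ℂ (H →L[ℂ] H))

/-- Regular free Herglotz functions from the ball over `B` to the right half plane over `B(H)`. -/
structure IsRegularHerglotz (f : GradedFun B H) : Prop where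
  free : IsFree f
  /-- twice the real part of `f(X)` is positive -/
  re_nonneg : ∀ (n : ℕ+) (X : MatBall B n), MatNonneg (f n X + (f n X).conjTranspose)
  map_zero : ∀ (n : ℕ+) (X : MatBall B n), X.1 = 0 → f n X = 1

section Transform

variable {K : Type*} [NormedAddCommGroup K] [InnerProductSpace ℂ K] [CompleteSpace K]

/-- The matrix `(U ⊗ I_n) · (α ⊗ 1_n)(X)`. -/
noncomputable def dilate (U : K →L[ℂ] K) (α : B →⋆ₐ[ℂ] (K →L[ℂ] K)) {n : ℕ}
    (X : Matrix (Fin n) (Fin n) B) : Matrix (Fin n) (Fin n) (K →L[ℂ] K) :=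
  Matrix.diagonal (fun _ => U) * X.map α

/-- The function `X ↦ (R ⊗ 1_n)[(I + (U ⊗ I_n)(α ⊗ 1_n)(X)) (I - (U ⊗ I_n)(α ⊗ 1_n)(X))⁻¹]`, where
`R : B(K) → B(H)` is the compression `T ↦ V* T V` to the subspace `H` of `K`, the inclusion being
the isometry `V`. -/
noncomputable def herglotzTransform (V : H →ₗᵢ[ℂ] K) (U : K →L[ℂ] K)
    (α : B →⋆ₐ[ℂ] (K →L[ℂ] K)) : GradedFun B H := fun _ X =>
  ((1 + dilate U α X.1) * Ring.inverse (1 - dilate U α X.1)).map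
    (fun T => (ContinuousLinearMap.adjoint V.toContinuousLinearMap) ∘L T ∘L
      V.toContinuousLinearMap)

/-- The inverse in `herglotzTransform` exists. -/
lemma isUnit_one_sub_dilate {U : K →L[ℂ] K} (hU : U ∈ unitary (K →L[ℂ] K))
    (α : B →⋆ₐ[ℂ] (K →L[ℂ] K)) {n : ℕ+} (X : MatBall B n) : IsUnit (1 - dilate U α X.1) := by
  set Y : CStarMatrix (Fin n) (Fin n) (K →L[ℂ] K) := CStarMatrix.ofMatrix (dilate U α X.1) with hY
  set D : CStarMatrix (Fin n) (Fin n) (K →L[ℂ] K) :=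
    CStarMatrix.ofMatrix (Matrix.diagonal (fun _ => U)) with hD
  have hYD : Y = D * CStarMatrix.mapₙₐ (α : B →⋆ₙₐ[ℂ] (K →L[ℂ] K)) (CStarMatrix.ofMatrix X.1) :=
    rfl
  have hDs : star D * D = 1 := by
    have h : (Matrix.diagonal (fun _ : Fin n => U)).conjTranspose *
        Matrix.diagonal (fun _ : Fin n => U) = 1 := by
      rw [Matrix.diagonal_conjTranspose, Matrix.diagonal_mul_diagonal, ← Matrix.diagonal_one]
      congr 1
      funext i
      exact hU.1
    exact h
  have h1 : ‖Y‖ < 1 := by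
    have h2 : ‖D‖ ≤ 1 := by
      rcases subsingleton_or_nontrivial (CStarMatrix (Fin n) (Fin n) (K →L[ℂ] K)) with h | h
      · rw [Subsingleton.elim D 0, norm_zero]; exact zero_le_one
      · have := CStarRing.norm_star_mul_self (x := D)
        rw [hDs, CStarRing.norm_one] at this
        nlinarith [norm_nonneg D]
    have h3 : ‖CStarMatrix.mapₙₐ (α : B →⋆ₙₐ[ℂ] (K →L[ℂ] K)) (CStarMatrix.ofMatrix X.1)‖ < 1 :=
      (NonUnitalStarAlgHom.norm_apply_le _ _).trans_lt X.2
    calc ‖Y‖ ≤ ‖D‖ * _ := by rw [hYD]; exact norm_mul_le _ _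
      _ ≤ 1 * _ := by gcongr
      _ < 1 := by rwa [one_mul]
  have h4 : IsUnit (1 - Y) := isUnit_one_sub_of_norm_lt_one h1
  exact h4.map (CStarMatrix.ofMatrixStarAlgEquiv (A := (K →L[ℂ] K)) (n := Fin n)).symm

end Transform

variable (B H) in
/-- The set of representable regular free Herglotz functions.  The Hilbert space `K` containing
`H`, the unitary `U` and the unital representation `α` may depend on the function. -/
def representableClass : Set (GradedFun B H) :=
  {f | IsRegularHerglotz f ∧
    ∃ (K : Type (max u v)) (_ : NormedAddCommGroup K) (_ : InnerProductSpace ℂ K)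
      (_ : CompleteSpace K) (V : H →ₗᵢ[ℂ] K) (U : K →L[ℂ] K) (α : B →⋆ₐ[ℂ] (K →L[ℂ] K)),
      U ∈ unitary (K →L[ℂ] K) ∧ f = herglotzTransform V U α}

/-- The function `g_φ` defined by an operator-valued state `φ` through the GNS construction. -/
noncomputable def gnsHerglotz (φ : OperatorState (FreeUnitary B) H) : GradedFun B H :=
  herglotzTransform φ.gnsEmbed (φ.gnsRep (FreeUnitary.gen B)) (φ.gnsRep.comp (FreeUnitary.of B))

end Functions

end FreeHerglotz

/-!
The proof rests on two facts about the free `*`-algebra `A = FreeUnitary B`.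

*The universal norm is finite.*  A `C*`-seminorm is at most `1` on unitaries, and a self-adjoint
contraction of `B` is the mean of two unitaries, so every `C*`-seminorm on `A` is dominated by the
norm of `B` on `B` (`IsCStarSeminorm.map_le_norm`) and is bounded on each word.  The supremum
defining the norm of `A` is therefore a genuine one, and every `*`-representation of `A` is
contractive (`FreeUnitary.norm_map_le`).  Hence for a representation `ρ` of `A` on `K` and an
isometry `V : H → K` the map `a ↦ V* ρ(a) V` is an operator-valued state (`stateOfRep`).

*A transform is determined by its moments.*  For `‖X‖ < 1` the operator `(1 + D) (1 - D)⁻¹` with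
`D = (U ⊗ I) (α ⊗ 1)(X)` is the norm limit of `1 + 2 (D + ⋯ + D ^ N)`.  The entries of the
compressed partial sums are values of `a ↦ V* ρ(a) V` at fixed elements of `A`, and the
error is bounded independently of `V` and `ρ` (`norm_matForm_herglotzTransform_sub_le`).

The uniformity of the error makes `φ ↦ g_φ` continuous.  A pair `(U, α)` extends to a representation
`ρ` of `A`, and the state of `(V, ρ)` has the same moments as its GNS representation; so every
representable function is some `g_φ` (`gnsHerglotz_stateOfRep`).  Conversely every transform is a
regular free Herglotz function: intertwiners pass through the resolvent, and the real part is
positive because `D` is a contraction (`matNonneg_cayley`).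

The states form a compact space because their matrix coefficients `⟨φ(a) h, k⟩` make up a closed
set in a product of discs (`OperatorState.isClosed_range_coeff`, `OperatorState.norm_coeff_le`).
The pointwise weak operator topology on graded functions is Hausdorff, so the image is closed.
-/

universe w

namespace FreeHerglotz

open scoped ComplexOrder TensorProduct

/-! ### The universal `C*`-seminorm dominates every `C*`-seminorm -/

namespace IsCStarSeminorm

variable {A : Type*} [Ring A] [StarRing A] [Algebra ℂ A] {p : Seminorm ℂ A}

lemma le_one_of_mem_unitary (hp : IsCStarSeminorm p) {x : A} (hx : x ∈ unitary A) : p x ≤ 1 := by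
  have h1 : p (1 : A) = p 1 ^ 2 := by simpa using hp.star_mul_self 1
  have h2 : p (1 : A) ≤ 1 := by nlinarith [apply_nonneg p (1 : A)]
  have h3 := hp.star_mul_self x
  rw [(Unitary.mem_iff.mp hx).1] at h3
  nlinarith [apply_nonneg p x]

open Complex in
/-- `C*`-seminorms are contractive along `*`-homomorphisms from `C*`-algebras: a self-adjoint
contraction is the mean of a unitary and its adjoint, and `p (b* b) = p b ^ 2` reduces the general
case to that of self-adjoint elements. -/
lemma map_le_norm {B : Type*} [CStarAlgebra B] [StarModule ℂ A] (hp : IsCStarSeminorm p)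
    (α : B →⋆ₐ[ℂ] A) (b : B) : p (α b) ≤ ‖b‖ := by
  -- `a = (w + w*) / 2` with the unitary `w = a + i √(1 - a ^ 2)`.
  have key (a : selfAdjoint B) (ha : ‖a‖ ≤ 1) : p (α a) ≤ 1 := by
    let _ := CStarAlgebra.spectralOrder B
    let _ := CStarAlgebra.spectralOrderedRing B
    set w := selfAdjoint.unitarySelfAddISMul a ha with hw
    have h1 : (a : B) = (2⁻¹ : ℂ) • ((w : B) + star (w : B)) := by
      rw [hw, selfAdjoint.star_coe_unitarySelfAddISMul]
      simp only [selfAdjoint.unitarySelfAddISMul_coe]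
      module
    have h2 : p (α w) ≤ 1 := hp.le_one_of_mem_unitary (Unitary.map_mem α w.2)
    have h3 : p (α (star (w : B))) ≤ 1 :=
      hp.le_one_of_mem_unitary (Unitary.map_mem α (Unitary.star_mem w.2))
    rw [h1, map_smul, map_add, map_smul_eq_mul]
    have := map_add_le_add p (α w) (α (star (w : B)))
    norm_num
    linarith
  have key2 (a : B) (ha : IsSelfAdjoint a) : p (α a) ≤ ‖a‖ := by
    rcases eq_or_ne a 0 with rfl | h0
    · simp
    have hpos : 0 < ‖a‖ := norm_pos_iff.mpr h0
    have hsa : IsSelfAdjoint ((‖a‖⁻¹ : ℝ) • a) := (IsSelfAdjoint.all _).smul ha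
    have h1 := key ⟨_, hsa⟩ (by
      change ‖(‖a‖⁻¹ : ℝ) • a‖ ≤ 1
      rw [norm_smul, norm_inv, norm_norm, inv_mul_cancel₀ hpos.ne'])
    have h2 : (‖a‖⁻¹ : ℝ) • a = ((‖a‖⁻¹ : ℝ) : ℂ) • a := (Complex.coe_smul _ _).symm
    simp only at h1
    rw [h2, map_smul, map_smul_eq_mul, Complex.norm_real, norm_inv, norm_norm,
      inv_mul_le_one₀ hpos] at h1
    exact h1
  have h1 := key2 (star b * b) (IsSelfAdjoint.star_mul_self b)
  rw [map_mul, map_star, hp.star_mul_self, CStarRing.norm_star_mul_self, ← sq] at h1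
  exact abs_le_of_sq_le_sq' h1 (norm_nonneg b) |>.2

end IsCStarSeminorm

namespace FreeUnitary

variable {B : Type u} [CStarAlgebra B]

lemma mk_single_inr_mem_unitary (k : Multiplicative ℤ) :
    mk B (MonoidAlgebra.single (Monoid.Coprod.inr k) 1) ∈ unitary (FreeUnitary B) := by
  have h1 : mk B (MonoidAlgebra.single 1 1) = 1 := map_one (mk B)
  constructor
  · rw [← mk_star, star_single, ← map_mul, MonoidAlgebra.single_mul_single]
    simp [← map_mul, h1]
  · rw [← mk_star, star_single, ← map_mul, MonoidAlgebra.single_mul_single]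
    simp [← map_mul, h1]

lemma exists_isCStarSeminorm_bound (x : FreeUnitary B) :
    ∃ C : ℝ, ∀ p : Seminorm ℂ (FreeUnitary B), IsCStarSeminorm p → p x ≤ C := by
  have key (z : WordMonoid B) : ∃ C : ℝ, ∀ p : Seminorm ℂ (FreeUnitary B), IsCStarSeminorm p →
      p (mk B (MonoidAlgebra.single z 1)) ≤ C := by
    induction z using Monoid.Coprod.induction_on with
    | inl b => exact ⟨‖b‖, fun p hp => hp.map_le_norm (of B) b⟩
    | inr k => exact ⟨1, fun p hp => hp.le_one_of_mem_unitary (mk_single_inr_mem_unitary k)⟩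
    | mul y z hy hz =>
      obtain ⟨C, hC⟩ := hy
      obtain ⟨D, hD⟩ := hz
      refine ⟨C * D, fun p hp => ?_⟩
      have h : mk B (MonoidAlgebra.single (y * z) 1) =
          mk B (MonoidAlgebra.single y 1) * mk B (MonoidAlgebra.single z 1) := by
        rw [← map_mul, MonoidAlgebra.single_mul_single, one_mul]
      rw [h]
      exact (hp.mul_le _ _).trans (mul_le_mul (hC p hp) (hD p hp) (apply_nonneg _ _)
        ((apply_nonneg p _).trans (hC p hp)))
  obtain ⟨x, rfl⟩ := mk_surjective B x
  induction x using MonoidAlgebra.induction_linear with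
  | zero => exact ⟨0, fun p _ => by simp⟩
  | add f g hf hg =>
    obtain ⟨C, hC⟩ := hf
    obtain ⟨D, hD⟩ := hg
    refine ⟨C + D, fun p hp => ?_⟩
    rw [map_add]
    exact (map_add_le_add p _ _).trans (add_le_add (hC p hp) (hD p hp))
  | single z c =>
    obtain ⟨C, hC⟩ := key z
    refine ⟨‖c‖ * C, fun p hp => ?_⟩
    have h : mk B (MonoidAlgebra.single z c) = c • mk B (MonoidAlgebra.single z 1) := by
      rw [← map_smul, MonoidAlgebra.smul_single, smul_eq_mul, mul_one]
    rw [h, map_smul_eq_mul]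
    exact mul_le_mul_of_nonneg_left (hC p hp) (norm_nonneg c)

/-- The supremum defining the norm is over a bounded set, so it is an upper bound. -/
lemma isCStarSeminorm_le_norm {p : Seminorm ℂ (FreeUnitary B)} (hp : IsCStarSeminorm p)
    (x : FreeUnitary B) : p x ≤ ‖x‖ := by
  obtain ⟨C, hC⟩ := exists_isCStarSeminorm_bound x
  refine le_csSup ⟨C, ?_⟩ ⟨p, hp, rfl⟩
  rintro _ ⟨q, hq, rfl⟩
  exact hC q hq

/-- A `*`-homomorphism `ρ` to a `C*`-algebra is contractive, as `‖ρ ·‖` is a `C*`-seminorm. -/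
lemma norm_map_le {D : Type*} [CStarAlgebra D] (ρ : FreeUnitary B →⋆ₐ[ℂ] D) (x : FreeUnitary B) :
    ‖ρ x‖ ≤ ‖x‖ := by
  let p : Seminorm ℂ (FreeUnitary B) := (normSeminorm ℂ D).comp (ρ : FreeUnitary B →ₗ[ℂ] D)
  have hp : IsCStarSeminorm p :=
    { mul_le := fun a b => by
        change ‖ρ (a * b)‖ ≤ ‖ρ a‖ * ‖ρ b‖
        rw [map_mul]
        exact norm_mul_le _ _
      star_mul_self := fun a => by
        change ‖ρ (star a * a)‖ = ‖ρ a‖ ^ 2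
        rw [map_mul, map_star, CStarRing.norm_star_mul_self, sq] }
  exact isCStarSeminorm_le_norm hp x

/-! ### The universal property -/

section Lift

variable {A : Type w} [Ring A] [StarRing A] [Algebra ℂ A]

/-- The multiplicative map on words sending the elements of `B` and the letter `u` to their
prescribed images. -/
def wordLift (α : B →⋆ₐ[ℂ] A) (U : unitary A) : WordMonoid B →* A :=
  Monoid.Coprod.lift (α : B →* A) ((unitary A).subtype.comp (zpowersHom (unitary A) U))

lemma wordLift_star (α : B →⋆ₐ[ℂ] A) (U : unitary A) (z : WordMonoid B) :
    wordLift α U (wordStarHom B z).unop = star (wordLift α U z) := by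
  induction z using Monoid.Coprod.induction_on with
  | inl b => simp [wordLift, map_star]
  | inr k =>
    simp only [wordLift, wordStarHom_inr, MulOpposite.unop_op, Monoid.Coprod.lift_apply_inr,
      MonoidHom.comp_apply, map_inv, ← Unitary.star_eq_inv]
    rfl
  | mul x y hx hy => rw [map_mul, MulOpposite.unop_mul, map_mul, hx, hy, map_mul, star_mul]

/-- The algebra homomorphism extending `α` and sending the free unitary to `U`. -/
noncomputable def liftAlgHom (α : B →⋆ₐ[ℂ] A) (U : unitary A) : FreeUnitary B →ₐ[ℂ] A :=
  RingQuot.liftAlgHom ℂ ⟨MonoidAlgebra.lift ℂ A _ (wordLift α U), by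
    rintro _ _ (⟨a, b⟩ | ⟨c, a⟩)
    · simp [wordLift]
    · simp [wordLift]⟩

lemma liftAlgHom_mk (α : B →⋆ₐ[ℂ] A) (U : unitary A) (x : MonoidAlgebra ℂ (WordMonoid B)) :
    liftAlgHom α U (mk B x) = MonoidAlgebra.lift ℂ A _ (wordLift α U) x :=
  RingQuot.liftAlgHom_mkAlgHom_apply ℂ _ _ x

variable [StarModule ℂ A]

/-- The unital `*`-homomorphism extending `α` and sending the free unitary to `U`. -/
noncomputable def lift (α : B →⋆ₐ[ℂ] A) (U : unitary A) : FreeUnitary B →⋆ₐ[ℂ] A where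
  __ := liftAlgHom α U
  map_star' x := by
    change liftAlgHom α U (star x) = star (liftAlgHom α U x)
    obtain ⟨x, rfl⟩ := mk_surjective B x
    rw [← mk_star, liftAlgHom_mk, liftAlgHom_mk]
    induction x using MonoidAlgebra.induction_linear with
    | zero => simp
    | add f g hf hg => rw [star_add, map_add, map_add, star_add, hf, hg]
    | single z c => simp [star_single, wordLift_star, MonoidAlgebra.lift_single]

lemma lift_mk (α : B →⋆ₐ[ℂ] A) (U : unitary A) (x : MonoidAlgebra ℂ (WordMonoid B)) :
    lift α U (mk B x) = MonoidAlgebra.lift ℂ A _ (wordLift α U) x :=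
  liftAlgHom_mk α U x

lemma lift_gen (α : B →⋆ₐ[ℂ] A) (U : unitary A) : lift α U (gen B) = U := by
  simp [gen, lift_mk, wordLift]

lemma lift_comp_of (α : B →⋆ₐ[ℂ] A) (U : unitary A) : (lift α U).comp (of B) = α := by
  ext b
  change lift α U (mk B _) = α b
  simp [lift_mk, wordLift]

end Lift

end FreeUnitary

/-! ### Operator matrices and compressions -/

section OperatorMatrices

variable {H : Type*} [NormedAddCommGroup H] [InnerProductSpace ℂ H]

lemma matForm_add {n : ℕ} (M N : Matrix (Fin n) (Fin n) (H →L[ℂ] H)) (h k : Fin n → H) :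
    matForm (M + N) h k = matForm M h k + matForm N h k := by
  simp [matForm, inner_add_right, Finset.sum_add_distrib]

lemma matForm_sub {n : ℕ} (M N : Matrix (Fin n) (Fin n) (H →L[ℂ] H)) (h k : Fin n → H) :
    matForm (M - N) h k = matForm M h k - matForm N h k := by
  simp [matForm, inner_sub_right, Finset.sum_sub_distrib]

/-- The numbers `⟨M h, k⟩` determine the entries of the operator matrix `M`. -/
lemma matForm_injective {n : ℕ} {M N : Matrix (Fin n) (Fin n) (H →L[ℂ] H)}
    (hMN : ∀ h k, matForm M h k = matForm N h k) : M = N := by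
  ext i j x
  refine ext_inner_left ℂ fun y => ?_
  have key (P : Matrix (Fin n) (Fin n) (H →L[ℂ] H)) :
      matForm P (Pi.single j x) (Pi.single i y) = inner ℂ y (P i j x) := by
    rw [matForm, Finset.sum_eq_single i, Finset.sum_eq_single j]
    · simp
    · intro l _ hl
      simp [Pi.single_eq_of_ne hl]
    · simp
    · intro l _ hl
      simp [Pi.single_eq_of_ne hl]
    · simp
  rw [← key, ← key, hMN]

variable [CompleteSpace H]

lemma matNonneg_conjTranspose_mul_self {n : ℕ} (E : Matrix (Fin n) (Fin n) (H →L[ℂ] H)) :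
    MatNonneg (E.conjTranspose * E) := by
  intro h
  have key : matForm (E.conjTranspose * E) h h =
      ∑ l, inner ℂ (∑ i, E l i (h i)) (∑ j, E l j (h j)) := by
    simp only [matForm, Matrix.mul_apply, Matrix.conjTranspose_apply,
      ContinuousLinearMap.star_eq_adjoint, sum_apply,
      mul_apply_eq_comp, inner_sum, sum_inner, ContinuousLinearMap.adjoint_inner_right]
    rw [Finset.sum_congr rfl fun i _ => Finset.sum_comm, Finset.sum_comm]
    exact Finset.sum_congr rfl fun l _ => Finset.sum_comm
  rw [key]
  refine Finset.sum_nonneg fun l _ => ?_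
  rw [inner_self_eq_norm_sq_to_K]
  exact pow_nonneg (RCLike.ofReal_nonneg.mpr (norm_nonneg _)) 2

lemma norm_matForm_le {n : ℕ} (M : Matrix (Fin n) (Fin n) (H →L[ℂ] H)) (h k : Fin n → H) :
    ‖matForm M h k‖ ≤ ‖CStarMatrix.ofMatrix M‖ * ∑ i, ∑ j, ‖h j‖ * ‖k i‖ := by
  simp only [matForm, Finset.mul_sum]
  refine norm_sum_le_of_le _ fun i _ => norm_sum_le_of_le _ fun j _ => ?_
  calc ‖inner ℂ (k i) (M i j (h j))‖ ≤ ‖k i‖ * (‖M i j‖ * ‖h j‖) :=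
        (norm_inner_le_norm _ _).trans (by gcongr; exact (M i j).le_opNorm _)
    _ = ‖M i j‖ * (‖h j‖ * ‖k i‖) := by ring
    _ ≤ ‖CStarMatrix.ofMatrix M‖ * (‖h j‖ * ‖k i‖) := by
      gcongr
      exact CStarMatrix.norm_entry_le_norm (M := CStarMatrix.ofMatrix M)

variable {K : Type*} [NormedAddCommGroup K] [InnerProductSpace ℂ K] [CompleteSpace K]

/-- The compression `T ↦ V* T V` along an isometry `V`. -/
noncomputable def compression (V : H →ₗᵢ[ℂ] K) : (K →L[ℂ] K) →ₗ[ℂ] (H →L[ℂ] H) where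
  toFun T := (ContinuousLinearMap.adjoint V.toContinuousLinearMap) ∘L T ∘L V.toContinuousLinearMap
  map_add' S T := by simp
  map_smul' c T := by simp

lemma inner_compression (V : H →ₗᵢ[ℂ] K) (T : K →L[ℂ] K) (h k : H) :
    inner ℂ k (compression V T h) = inner ℂ (V k) (T (V h)) := by
  simp [compression, ContinuousLinearMap.adjoint_inner_right]

lemma compression_one (V : H →ₗᵢ[ℂ] K) : compression V 1 = 1 := by
  ext h
  refine ext_inner_left ℂ fun k => ?_
  simp [inner_compression]

lemma compression_star (V : H →ₗᵢ[ℂ] K) (T : K →L[ℂ] K) :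
    compression V (star T) = star (compression V T) := by
  ext h
  refine ext_inner_left ℂ fun k => ?_
  rw [inner_compression, ContinuousLinearMap.star_eq_adjoint, ContinuousLinearMap.star_eq_adjoint,
    ContinuousLinearMap.adjoint_inner_right, ContinuousLinearMap.adjoint_inner_right,
    ← inner_conj_symm, ← inner_compression, inner_conj_symm]

lemma matForm_map_compression (V : H →ₗᵢ[ℂ] K) {n : ℕ} (M : Matrix (Fin n) (Fin n) (K →L[ℂ] K))
    (h k : Fin n → H) :
    matForm (M.map (compression V)) h k = matForm M (fun i => V (h i)) (fun i => V (k i)) := by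
  simp [matForm, inner_compression]

end OperatorMatrices

section ScalarMatrices

variable {R S : Type*} [Ring R] [Algebra ℂ R] [Ring S] [Algebra ℂ S]
variable {n m : ℕ}

lemma map_scalar_mul (f : R →ₗ[ℂ] S) (Γ : Matrix (Fin m) (Fin n) ℂ) (M : Matrix (Fin n) (Fin n) R) :
    (Γ.map (algebraMap ℂ R) * M).map f = Γ.map (algebraMap ℂ S) * M.map f := by
  ext i j
  simp [Matrix.mul_apply, ← Algebra.smul_def]

lemma map_mul_scalar (f : R →ₗ[ℂ] S) (Γ : Matrix (Fin m) (Fin n) ℂ) (M : Matrix (Fin m) (Fin m) R) :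
    (M * Γ.map (algebraMap ℂ R)).map f = M.map f * Γ.map (algebraMap ℂ S) := by
  ext i j
  simp [Matrix.mul_apply, ← Algebra.commutes, ← Algebra.smul_def]

lemma scalar_mul_diagonal (Γ : Matrix (Fin m) (Fin n) ℂ) (x : R) :
    Γ.map (algebraMap ℂ R) * (Matrix.diagonal fun _ => x : Matrix (Fin n) (Fin n) R) =
      (Matrix.diagonal fun _ => x : Matrix (Fin m) (Fin m) R) * Γ.map (algebraMap ℂ R) := by
  ext i j
  rw [Matrix.mul_diagonal, Matrix.diagonal_mul]
  exact Algebra.commutes _ _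

end ScalarMatrices

/-! ### Transforms of representations are regular free Herglotz functions -/

section Regularity

variable {B : Type u} [CStarAlgebra B] [PartialOrder B] [StarOrderedRing B]
variable {H : Type v} [NormedAddCommGroup H] [InnerProductSpace ℂ H] [CompleteSpace H]
variable {K : Type w} [NormedAddCommGroup K] [InnerProductSpace ℂ K] [CompleteSpace K]

lemma herglotzTransform_apply (V : H →ₗᵢ[ℂ] K) (U : K →L[ℂ] K) (α : B →⋆ₐ[ℂ] (K →L[ℂ] K))
    (n : ℕ+) (X : MatBall B n) :
    herglotzTransform V U α n X =
      ((1 + dilate U α X.1) * Ring.inverse (1 - dilate U α X.1)).map (compression V) := rfl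

lemma norm_dilate_le {U : K →L[ℂ] K} (hU : U ∈ unitary (K →L[ℂ] K))
    (α : B →⋆ₐ[ℂ] (K →L[ℂ] K)) {n : ℕ} (X : Matrix (Fin n) (Fin n) B) :
    ‖CStarMatrix.ofMatrix (dilate U α X)‖ ≤ ‖CStarMatrix.ofMatrix X‖ := by
  set D : CStarMatrix (Fin n) (Fin n) (K →L[ℂ] K) :=
    CStarMatrix.ofMatrix (Matrix.diagonal (fun _ => U)) with hD
  have hYD : CStarMatrix.ofMatrix (dilate U α X) =
    D * CStarMatrix.mapₙₐ (α : B →⋆ₙₐ[ℂ] (K →L[ℂ] K)) (CStarMatrix.ofMatrix X) := rfl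
  have hDs : star D * D = 1 := by
    have h : (Matrix.diagonal (fun _ : Fin n => U)).conjTranspose *
        Matrix.diagonal (fun _ : Fin n => U) = 1 := by
      rw [Matrix.diagonal_conjTranspose, Matrix.diagonal_mul_diagonal, ← Matrix.diagonal_one]
      congr 1
      funext i
      exact hU.1
    exact h
  have h2 : ‖D * CStarMatrix.mapₙₐ (α : B →⋆ₙₐ[ℂ] (K →L[ℂ] K)) (CStarMatrix.ofMatrix X)‖ =
      ‖CStarMatrix.mapₙₐ (α : B →⋆ₙₐ[ℂ] (K →L[ℂ] K)) (CStarMatrix.ofMatrix X)‖ := by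
    rw [← sq_eq_sq₀ (norm_nonneg _) (norm_nonneg _), sq, sq, ← CStarRing.norm_star_mul_self,
      ← CStarRing.norm_star_mul_self, star_mul, mul_assoc, ← mul_assoc (star D), hDs, one_mul]
  rw [hYD, h2]
  exact NonUnitalStarAlgHom.norm_apply_le _ _

lemma isFree_herglotzTransform (V : H →ₗᵢ[ℂ] K) {U : K →L[ℂ] K} (hU : U ∈ unitary (K →L[ℂ] K))
    (α : B →⋆ₐ[ℂ] (K →L[ℂ] K)) : IsFree (herglotzTransform V U α) := by
  intro n m Γ X Y hXY
  rw [herglotzTransform_apply, herglotzTransform_apply, ← map_scalar_mul, ← map_mul_scalar]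
  congr 1
  set G := Γ.map (algebraMap ℂ (K →L[ℂ] K)) with hG
  set D := dilate U α X.1 with hD
  set E := dilate U α Y.1 with hE
  have hDE : G * D = E * G := by
    have h1 := congrArg (fun M => M.map (α.toAlgHom.toLinearMap : B →ₗ[ℂ] (K →L[ℂ] K))) hXY
    simp only [map_scalar_mul, map_mul_scalar] at h1
    rw [hD, hE, dilate, dilate, ← Matrix.mul_assoc, hG, scalar_mul_diagonal, Matrix.mul_assoc,
      Matrix.mul_assoc]
    exact congrArg (fun M => Matrix.diagonal (fun _ => U) * M) h1
  have hD1 : (1 - D) * Ring.inverse (1 - D) = 1 :=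
    Ring.mul_inverse_cancel _ (isUnit_one_sub_dilate hU α X)
  have hE1 : Ring.inverse (1 - E) * (1 - E) = 1 :=
    Ring.inverse_mul_cancel _ (isUnit_one_sub_dilate hU α Y)
  have h3 : G * (1 - D) = (1 - E) * G := by
    rw [Matrix.mul_sub, Matrix.sub_mul, hDE, Matrix.mul_one, Matrix.one_mul]
  have h4 : G * (1 + D) = (1 + E) * G := by
    rw [Matrix.mul_add, Matrix.add_mul, hDE, Matrix.mul_one, Matrix.one_mul]
  have h5 : G * Ring.inverse (1 - D) = Ring.inverse (1 - E) * G := by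
    calc G * Ring.inverse (1 - D) = Ring.inverse (1 - E) * (1 - E) * G * Ring.inverse (1 - D) := by
          rw [hE1, Matrix.one_mul]
      _ = Ring.inverse (1 - E) * (G * (1 - D)) * Ring.inverse (1 - D) := by
          rw [h3, Matrix.mul_assoc (Ring.inverse (1 - E))]
      _ = Ring.inverse (1 - E) * G * ((1 - D) * Ring.inverse (1 - D)) := by
          simp only [Matrix.mul_assoc]
      _ = Ring.inverse (1 - E) * G := by rw [hD1, Matrix.mul_one]
  rw [← Matrix.mul_assoc, h4, Matrix.mul_assoc, h5, Matrix.mul_assoc]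

omit [PartialOrder B] [StarOrderedRing B] in
lemma exists_one_sub_star_mul_self_eq {x : B} (hx : ‖x‖ ≤ 1) :
    ∃ e : B, 1 - star x * x = star e * e := by
  let _ := CStarAlgebra.spectralOrder B
  let _ := CStarAlgebra.spectralOrderedRing B
  refine CStarAlgebra.nonneg_iff_eq_star_mul_self.mp (sub_nonneg.mpr ?_)
  rw [← CStarAlgebra.norm_le_one_iff_of_nonneg _ (star_mul_self_nonneg x),
    CStarRing.norm_star_mul_self]
  exact mul_le_one₀ hx (norm_nonneg _) hx

/-- With `Q = (1 - D)⁻¹`, twice the real part of `(1 + D) Q` is `2 Q* (1 - D* D) Q`, and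
`1 - D* D` is positive for a contraction `D`. -/
lemma matNonneg_cayley {n : ℕ} {D Q : Matrix (Fin n) (Fin n) (K →L[ℂ] K)}
    (hD : ‖CStarMatrix.ofMatrix D‖ ≤ 1) (hQ : (1 - D) * Q = 1) :
    MatNonneg ((1 + D) * Q + ((1 + D) * Q).conjTranspose) := by
  obtain ⟨E, hE⟩ : ∃ E : Matrix (Fin n) (Fin n) (K →L[ℂ] K),
      1 - D.conjTranspose * D = E.conjTranspose * E := by
    obtain ⟨E, hE⟩ := exists_one_sub_star_mul_self_eq hD
    exact ⟨CStarMatrix.ofMatrix.symm E, hE⟩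
  have hQ' : Q.conjTranspose * (1 - D.conjTranspose) = 1 := by
    simpa using congrArg Matrix.conjTranspose hQ
  have key : (1 + D) * Q + ((1 + D) * Q).conjTranspose =
      (E * Q).conjTranspose * (E * Q) + (E * Q).conjTranspose * (E * Q) := by
    have h1 : (E * Q).conjTranspose * (E * Q) =
        Q.conjTranspose * (1 - D.conjTranspose * D) * Q := by
      rw [hE, Matrix.conjTranspose_mul]
      simp only [mul_assoc]
    have h2 : (1 + D) * Q = Q.conjTranspose * (1 - D.conjTranspose) * ((1 + D) * Q) := by
      rw [hQ', one_mul]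
    have h3 : ((1 + D) * Q).conjTranspose =
        Q.conjTranspose * (1 + D.conjTranspose) * ((1 - D) * Q) := by
      rw [hQ, mul_one, Matrix.conjTranspose_mul, Matrix.conjTranspose_add,
        Matrix.conjTranspose_one]
    rw [h1, h3]
    nth_rewrite 1 [h2]
    noncomm_ring
  intro h
  rw [key, matForm_add]
  exact add_nonneg (matNonneg_conjTranspose_mul_self _ h) (matNonneg_conjTranspose_mul_self _ h)

lemma isRegularHerglotz_herglotzTransform (V : H →ₗᵢ[ℂ] K) {U : K →L[ℂ] K}
    (hU : U ∈ unitary (K →L[ℂ] K)) (α : B →⋆ₐ[ℂ] (K →L[ℂ] K)) :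
    IsRegularHerglotz (herglotzTransform V U α) where
  free := isFree_herglotzTransform V hU α
  re_nonneg n X h := by
    have h1 := matNonneg_cayley ((norm_dilate_le hU α X.1).trans X.2.le)
      (Ring.mul_inverse_cancel _ (isUnit_one_sub_dilate hU α X)) (fun i => V (h i))
    rw [← matForm_map_compression] at h1
    convert h1 using 2
    ext1 i j
    simp only [herglotzTransform_apply, Matrix.add_apply, Matrix.map_apply,
      Matrix.conjTranspose_apply, map_add, compression_star]
  map_zero n X hX := by
    have h1 : dilate U α X.1 = 0 := by
      rw [dilate, hX, Matrix.map_zero _ (map_zero α), mul_zero]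
    rw [herglotzTransform_apply, h1, add_zero, sub_zero, Ring.inverse_one, mul_one]
    ext1 i j
    rcases eq_or_ne i j with rfl | hij
    · simp [compression_one]
    · simp [hij]

end Regularity

/-! ### Approximation by moments -/

section Moments

/-- The truncation `1 + 2 (x + ⋯ + x ^ N)` of the power series of `(1 + x) (1 - x)⁻¹`. -/
def cayleySum {R : Type*} [Ring R] (N : ℕ) (x : R) : R :=
  1 + 2 * (x * ∑ m ∈ Finset.range N, x ^ m)

lemma map_cayleySum {R S : Type*} [Ring R] [Ring S] (f : R →+* S) (N : ℕ) (x : R) :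
    f (cayleySum N x) = cayleySum N (f x) := by
  simp [cayleySum, map_ofNat f 2]

lemma norm_cayley_sub_cayleySum_le {A : Type*} [CStarAlgebra A] {x y : A} {r : ℝ} (hx : ‖x‖ ≤ r)
    (hr : r < 1) (hy : (1 - x) * y = 1) (N : ℕ) :
    ‖(1 + x) * y - cayleySum N x‖ ≤ 2 * r ^ (N + 1) / (1 - r) := by
  have h1 : (1 + x) * y - cayleySum N x = 2 * (x ^ (N + 1) * y) := by
    -- Telescoping the geometric sum leaves only the term of degree `N + 1`.
    have h2 : cayleySum N x * (1 - x) = 1 + x - 2 * x ^ (N + 1) := by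
      rw [cayleySum, add_mul, one_mul, mul_assoc, mul_assoc, geom_sum_mul_neg, mul_sub, mul_one,
        ← pow_succ']
      noncomm_ring
    calc (1 + x) * y - cayleySum N x = (1 + x) * y - cayleySum N x * ((1 - x) * y) := by
          rw [hy, mul_one]
      _ = ((1 + x) - cayleySum N x * (1 - x)) * y := by rw [sub_mul (1 + x), mul_assoc]
      _ = 2 * (x ^ (N + 1) * y) := by rw [h2, sub_sub_cancel, mul_assoc]
  -- Not an equality: the algebra may be trivial.
  have hone : ‖(1 : A)‖ ≤ 1 := by
    have := CStarRing.norm_star_mul_self (x := (1 : A))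
    rw [star_one, one_mul] at this
    nlinarith [norm_nonneg (1 : A)]
  have hr0 : 0 ≤ r := (norm_nonneg x).trans hx
  have h3 : ‖y‖ ≤ 1 / (1 - r) := by
    have h4 : y = 1 + x * y := by
      rw [sub_mul, one_mul, sub_eq_iff_eq_add] at hy
      exact hy
    have h5 : ‖y‖ ≤ 1 + r * ‖y‖ := by
      calc ‖y‖ = ‖1 + x * y‖ := by rw [← h4]
        _ ≤ ‖(1 : A)‖ + ‖x * y‖ := norm_add_le _ _
        _ ≤ 1 + r * ‖y‖ := by
          gcongr
          exact (norm_mul_le _ _).trans (by gcongr)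
    rw [le_div_iff₀ (by linarith)]
    linarith
  have h6 : ‖x ^ (N + 1)‖ ≤ r ^ (N + 1) :=
    (norm_pow_le' x N.succ_pos).trans (by gcongr)
  calc ‖(1 + x) * y - cayleySum N x‖ = ‖x ^ (N + 1) * y + x ^ (N + 1) * y‖ := by rw [h1, two_mul]
    _ ≤ ‖x ^ (N + 1) * y‖ + ‖x ^ (N + 1) * y‖ := norm_add_le _ _
    _ ≤ r ^ (N + 1) * (1 / (1 - r)) + r ^ (N + 1) * (1 / (1 - r)) := by
      have := (norm_mul_le (x ^ (N + 1)) y).trans (mul_le_mul h6 h3 (norm_nonneg _) (by positivity))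
      exact add_le_add this this
    _ = _ := by ring

variable {B : Type u} [CStarAlgebra B] [PartialOrder B] [StarOrderedRing B]
variable {H : Type v} [NormedAddCommGroup H] [InnerProductSpace ℂ H] [CompleteSpace H]
variable {K : Type w} [NormedAddCommGroup K] [InnerProductSpace ℂ K] [CompleteSpace K]

variable (B) in
/-- The matrix `(u ⊗ I_n) X` over the free `*`-algebra. -/
noncomputable def genMul {n : ℕ} (X : Matrix (Fin n) (Fin n) B) :
    Matrix (Fin n) (Fin n) (FreeUnitary B) :=
  Matrix.diagonal (fun _ => FreeUnitary.gen B) * X.map (FreeUnitary.of B)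

/-- The truncated series of the transform of `(V, ρ)` has as entries the values of `a ↦ V* ρ(a) V`
at fixed elements of the free `*`-algebra, and the truncation error is bounded independently of
`V` and `ρ`. -/
lemma norm_matForm_herglotzTransform_sub_le (V : H →ₗᵢ[ℂ] K)
    (ρ : FreeUnitary B →⋆ₐ[ℂ] (K →L[ℂ] K)) {n : ℕ+} (X : MatBall B n) (h k : Fin n → H) (N : ℕ) :
    ‖matForm (herglotzTransform V (ρ (FreeUnitary.gen B)) (ρ.comp (FreeUnitary.of B)) n X) h k -
      matForm ((cayleySum N (genMul B X.1)).map (fun a => compression V (ρ a))) h k‖ ≤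
    2 * ‖CStarMatrix.ofMatrix X.1‖ ^ (N + 1) / (1 - ‖CStarMatrix.ofMatrix X.1‖) *
      ∑ i, ∑ j, ‖h j‖ * ‖k i‖ := by
  have hU : ρ (FreeUnitary.gen B) ∈ unitary (K →L[ℂ] K) :=
    Unitary.map_mem ρ (FreeUnitary.gen_mem_unitary B)
  set D := dilate (ρ (FreeUnitary.gen B)) (ρ.comp (FreeUnitary.of B)) X.1 with hD
  have h1 : (cayleySum N (genMul B X.1)).map ρ = cayleySum N D := by
    have h2 : (genMul B X.1).map ρ = D := by
      ext1 i j
      simp [genMul, hD, dilate]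
    rw [← h2]
    exact map_cayleySum (R := Matrix (Fin n) (Fin n) (FreeUnitary B))
      (S := Matrix (Fin n) (Fin n) (K →L[ℂ] K))
      (RingHom.mapMatrix (ρ : FreeUnitary B →+* (K →L[ℂ] K))) N _
  have h3 : (cayleySum N (genMul B X.1)).map (fun a => compression V (ρ a)) =
      (cayleySum N D).map (compression V) := by
    rw [← h1, Matrix.map_map]
    rfl
  rw [herglotzTransform_apply, ← hD, h3, matForm_map_compression, matForm_map_compression,
    ← matForm_sub]
  have h4 := norm_cayley_sub_cayleySum_le (x := CStarMatrix.ofMatrix D)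
    (y := CStarMatrix.ofMatrix (Ring.inverse (1 - D))) (norm_dilate_le hU _ X.1) X.2
    (Ring.mul_inverse_cancel _ (isUnit_one_sub_dilate hU (ρ.comp (FreeUnitary.of B)) X)) N
  refine (norm_matForm_le _ _ _).trans ?_
  simp only [LinearIsometry.norm_map]
  exact mul_le_mul_of_nonneg_right h4 (by positivity)

end Moments

/-! ### Compactness of the space of operator-valued states -/

section Sesquilinear

variable {H : Type*} [NormedAddCommGroup H] [InnerProductSpace ℂ H] [CompleteSpace H]

/-- A bounded form, linear in the first and conjugate-linear in the second variable, is
`(h, k) ↦ ⟨T h, k⟩` for a bounded operator `T`. -/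
lemma exists_clm_of_sesquilinear (f : H → H → ℂ) (C : ℝ)
    (add_left : ∀ h h' k, f (h + h') k = f h k + f h' k)
    (smul_left : ∀ (c : ℂ) h k, f (c • h) k = c * f h k)
    (add_right : ∀ h k k', f h (k + k') = f h k + f h k')
    (smul_right : ∀ (c : ℂ) h k, f h (c • k) = star c * f h k)
    (bound : ∀ h k, ‖f h k‖ ≤ C * ‖h‖ * ‖k‖) :
    ∃ T : H →L[ℂ] H, ∀ h k, inner ℂ k (T h) = f h k := by
  -- The library pairing is conjugate-linear in its first variable, hence the conjugate of `f`.
  let F : H →ₗ⋆[ℂ] H →ₗ[ℂ] ℂ := LinearMap.mk₂'ₛₗ (starRingEnd ℂ) (RingHom.id ℂ)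
    (fun h k => star (f h k)) (fun h h' k => by simp [add_left])
    (fun c h k => by simp [smul_left]) (fun h k k' => by simp [add_right])
    (fun c h k => by simp [smul_right])
  let G : H →L⋆[ℂ] H →L[ℂ] ℂ := F.mkContinuous₂ C fun h k => by
    change ‖star (f h k)‖ ≤ _
    rw [norm_star]
    exact bound h k
  refine ⟨InnerProductSpace.continuousLinearMapOfBilin G, fun h k => ?_⟩
  rw [← inner_conj_symm, InnerProductSpace.continuousLinearMapOfBilin_apply]
  exact star_star (f h k)

end Sesquilinear

namespace OperatorState

variable {A : Type u} [Ring A] [StarRing A] [Algebra ℂ A] [StarModule ℂ A] [Norm A]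
variable {H : Type v} [NormedAddCommGroup H] [InnerProductSpace ℂ H]

/-- The matrix coefficients `⟨φ(a) h, k⟩`, which define the topology of the state space. -/
noncomputable def coeff (φ : OperatorState A H) (p : A × H × H) : ℂ :=
  inner ℂ p.2.2 (φ.toFun p.1 p.2.1)

omit [StarModule ℂ A] in
lemma isInducing_coeff :
    Topology.IsInducing (coeff : OperatorState A H → A × H × H → ℂ) := ⟨rfl⟩

omit [StarModule ℂ A] in
lemma continuous_inner_apply (a : A) (h k : H) :
    Continuous fun φ : OperatorState A H => inner ℂ k (φ.toFun a h) :=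
  (continuous_apply (a, h, k)).comp isInducing_coeff.continuous

/-- Operator-valued states are contractive: `⟨φ(a) h, k⟩` is the matrix coefficient
`⟨π_φ(a) (1 ⊗ h), 1 ⊗ k⟩` of the GNS representation. -/
lemma norm_coeff_le (φ : OperatorState A H) (a : A) (h k : H) :
    ‖φ.coeff (a, h, k)‖ ≤ Real.sqrt ‖star a * a‖ * ‖h‖ * ‖k‖ := by
  have h1 : φ.coeff (a, h, k) =
      inner ℂ (φ.toPreGNS (1 ⊗ₜ k)) (φ.preGNSMul a (φ.toPreGNS (1 ⊗ₜ h))) := by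
    rw [preGNSMul_apply, preGNS_inner]
    simp [coeff, gnsForm_tmul]
  have h2 (x : H) : ‖φ.toPreGNS (1 ⊗ₜ x)‖ = ‖x‖ := by
    rw [← UniformSpace.Completion.norm_coe]
    exact φ.gnsEmbed.norm_map x
  have h3 : ‖φ.preGNSMul a‖ ≤ Real.sqrt ‖star a * a‖ :=
    LinearMap.mkContinuous_norm_le _ (Real.sqrt_nonneg _) _
  calc ‖φ.coeff (a, h, k)‖ ≤ ‖k‖ * (Real.sqrt ‖star a * a‖ * ‖h‖) := by
        rw [h1]
        refine (norm_inner_le_norm _ _).trans ?_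
        rw [h2]
        gcongr
        refine ((φ.preGNSMul a).le_opNorm _).trans ?_
        rw [h2]
        gcongr
    _ = _ := by ring

/-- A pointwise limit of coefficient families inherits sesquilinearity, the bound, the unit and
the two positivity conditions, hence comes from an operator-valued state. -/
lemma isClosed_range_coeff [CompleteSpace H] :
    IsClosed (Set.range (coeff : OperatorState A H → A × H × H → ℂ)) := by
  refine isClosed_of_closure_subset fun F hF => ?_
  -- Closed conditions that hold for all coefficient families hold for `F`.
  have lim {P : Set (A × H × H → ℂ)} (hP : IsClosed P)
      (h : ∀ φ : OperatorState A H, φ.coeff ∈ P) : F ∈ P :=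
    closure_minimal (Set.range_subset_iff.mpr h) hP hF
  have ev (p : A × H × H) : Continuous fun G : A × H × H → ℂ => G p := continuous_apply p
  have hT (a : A) : ∃ T : H →L[ℂ] H, ∀ h k, inner ℂ k (T h) = F (a, h, k) := by
    refine exists_clm_of_sesquilinear (fun h k => F (a, h, k)) (Real.sqrt ‖star a * a‖)
      (fun h h' k => ?_) (fun c h k => ?_) (fun h k k' => ?_) (fun c h k => ?_) fun h k => ?_
    · exact lim (isClosed_eq (ev _) ((ev _).add (ev _))) fun φ => by simp [coeff]
    · exact lim (isClosed_eq (ev _) (continuous_const.mul (ev _))) fun φ => by simp [coeff]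
    · exact lim (isClosed_eq (ev _) ((ev _).add (ev _))) fun φ => by simp [coeff]
    · exact lim (isClosed_eq (ev _) (continuous_const.mul (ev _))) fun φ => by
        simp [coeff, mul_comm]
    · exact lim (isClosed_le (ev _).norm continuous_const) fun φ => norm_coeff_le φ a h k
  choose T hT using hT
  have hTF (n : ℕ) (a : Fin n → Fin n → A) (h : Fin n → H) :
      matForm (Matrix.of fun i j => T (a i j)) h h = ∑ i, ∑ j, F (a i j, h j, h i) := by
    simp [matForm, hT]
  have hpos {n : ℕ} (a : Fin n → Fin n → A)
      (ha : ∀ φ : OperatorState A H, MatNonneg (Matrix.of fun i j => φ.toFun (a i j))) :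
      MatNonneg (Matrix.of fun i j => T (a i j)) := fun h => by
    rw [hTF]
    exact lim (isClosed_le continuous_const
      (continuous_finsetSum _ fun i _ => continuous_finsetSum _ fun j _ => ev _)) fun φ => ha φ h
  refine ⟨{ toFun := { toFun := T
                       map_add' := fun a b => ?_
                       map_smul' := fun c a => ?_ }
            unital := ?_
            completely_positive := fun n a => hpos (fun i j => star (a i) * a j)
              fun φ => φ.completely_positive n a
            completely_bounded := fun n a b => hpos (fun i j => star (a i) *
              (algebraMap ℂ A (‖star b * b‖ : ℝ) - star b * b) * a j)
              fun φ => φ.completely_bounded n a b }, ?_⟩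
  · ext h
    refine ext_inner_left ℂ fun k => ?_
    rw [add_apply, inner_add_right, hT, hT, hT]
    exact lim (isClosed_eq (ev _) ((ev _).add (ev _))) fun φ => by simp [coeff]
  · ext h
    refine ext_inner_left ℂ fun k => ?_
    rw [smul_apply, inner_smul_right, hT, hT]
    exact lim (isClosed_eq (ev _) (continuous_const.mul (ev _))) fun φ => by simp [coeff]
  · ext h
    refine ext_inner_left ℂ fun k => ?_
    change inner ℂ k (T 1 h) = _
    rw [hT]
    exact lim (isClosed_eq (ev _) continuous_const) fun φ => by simp [coeff, φ.unital]
  · funext ⟨a, h, k⟩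
    exact hT a h k

lemma compactSpace [CompleteSpace H] : CompactSpace (OperatorState A H) := by
  refine ⟨isInducing_coeff.isCompact_iff.mpr ?_⟩
  rw [Set.image_univ]
  refine (isCompact_univ_pi fun p : A × H × H => isCompact_closedBall (0 : ℂ)
    (Real.sqrt ‖star p.1 * p.1‖ * ‖p.2.1‖ * ‖p.2.2‖)).of_isClosed_subset isClosed_range_coeff ?_
  rintro _ ⟨φ, rfl⟩ ⟨a, h, k⟩ -
  rw [mem_closedBall_zero_iff]
  exact norm_coeff_le φ a h k

lemma compression_gnsEmbed_gnsRep [CompleteSpace H] (φ : OperatorState A H) (a : A) :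
    compression φ.gnsEmbed (φ.gnsRep a) = φ.toFun a := by
  ext h
  refine ext_inner_left ℂ fun k => ?_
  rw [inner_compression]
  change inner ℂ ((φ.toPreGNS (1 ⊗ₜ k) : φ.PreGNS) : φ.GNS)
    ((φ.preGNSMul a).completion ((φ.toPreGNS (1 ⊗ₜ h) : φ.PreGNS) : φ.GNS)) = _
  rw [ContinuousLinearMap.completion_apply_coe, UniformSpace.Completion.inner_coe,
    preGNSMul_apply, preGNS_inner]
  simp [gnsForm_tmul]

end OperatorState

/-! ### States of representations -/

section StateOfRep

variable {B : Type u} [CStarAlgebra B]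
variable {H : Type v} [NormedAddCommGroup H] [InnerProductSpace ℂ H] [CompleteSpace H]
variable {K : Type w} [NormedAddCommGroup K] [InnerProductSpace ℂ K] [CompleteSpace K]

lemma matForm_compression_star_mul_mul {A : Type*} [Ring A] [StarRing A] [Algebra ℂ A]
    (V : H →ₗᵢ[ℂ] K) (ρ : A →⋆ₐ[ℂ] (K →L[ℂ] K)) (c : A) {n : ℕ} (a : Fin n → A) (h : Fin n → H) :
    matForm (Matrix.of fun i j => compression V (ρ (star (a i) * c * a j))) h h =
      inner ℂ (∑ i, ρ (a i) (V (h i))) (ρ c (∑ i, ρ (a i) (V (h i)))) := by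
  simp only [matForm, Matrix.of_apply, inner_compression, map_mul, map_star, map_sum, inner_sum,
    sum_inner, mul_apply_eq_comp, ContinuousLinearMap.star_eq_adjoint,
    ContinuousLinearMap.adjoint_inner_right]
  exact Finset.sum_comm

/-- The operator-valued state `a ↦ V* ρ(a) V` of a `*`-representation `ρ` and an isometry `V`. -/
noncomputable def stateOfRep (V : H →ₗᵢ[ℂ] K) (ρ : FreeUnitary B →⋆ₐ[ℂ] (K →L[ℂ] K)) :
    OperatorState (FreeUnitary B) H where
  toFun := compression V ∘ₗ ρ.toAlgHom.toLinearMap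
  unital := by
    change compression V (ρ 1) = 1
    rw [map_one, compression_one]
  completely_positive n a h := by
    have h1 := matForm_compression_star_mul_mul V ρ 1 a h
    simp only [mul_one, map_one, one_apply_eq_self] at h1
    change 0 ≤ matForm (Matrix.of fun i j => compression V (ρ (star (a i) * a j))) h h
    rw [h1, inner_self_eq_norm_sq_to_K]
    exact pow_nonneg (RCLike.ofReal_nonneg.mpr (norm_nonneg _)) 2
  completely_bounded n a b h := by
    change 0 ≤ matForm (Matrix.of fun i j => compression V (ρ (star (a i) *
      (algebraMap ℂ (FreeUnitary B) (‖star b * b‖ : ℝ) - star b * b) * a j))) h h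
    rw [matForm_compression_star_mul_mul]
    set y := ∑ i, ρ (a i) (V (h i))
    have h1 : ‖ρ b y‖ ^ 2 ≤ ‖star b * b‖ * ‖y‖ ^ 2 := by
      calc ‖ρ b y‖ ^ 2 ≤ (‖ρ b‖ * ‖y‖) ^ 2 := by
            gcongr
            exact (ρ b).le_opNorm y
        _ = ‖ρ (star b * b)‖ * ‖y‖ ^ 2 := by
            rw [map_mul, map_star, CStarRing.norm_star_mul_self]
            ring
        _ ≤ ‖star b * b‖ * ‖y‖ ^ 2 := by
            gcongr
            exact FreeUnitary.norm_map_le ρ _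
    have h2 : inner ℂ y
        (ρ (algebraMap ℂ (FreeUnitary B) (‖star b * b‖ : ℝ) - star b * b) y) =
        ((‖star b * b‖ * ‖y‖ ^ 2 - ‖ρ b y‖ ^ 2 : ℝ) : ℂ) := by
      rw [map_sub, AlgHomClass.commutes, Algebra.algebraMap_eq_smul_one, map_mul, map_star,
        sub_apply, inner_sub_right, mul_apply_eq_comp,
        ContinuousLinearMap.star_eq_adjoint, ContinuousLinearMap.adjoint_inner_right,
        inner_self_eq_norm_sq_to_K, smul_apply, one_apply_eq_self,
        inner_smul_right, inner_self_eq_norm_sq_to_K]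
      push_cast
      rfl
    rw [h2]
    exact Complex.zero_le_real.mpr (sub_nonneg.mpr h1)

end StateOfRep

/-! ### The map from states to functions -/

section Main

open Filter Topology

variable {B : Type u} [CStarAlgebra B] [PartialOrder B] [StarOrderedRing B]
variable {H : Type v} [NormedAddCommGroup H] [InnerProductSpace ℂ H] [CompleteSpace H]

lemma tendsto_truncation_bound {n : ℕ+} (X : MatBall B n) (C : ℝ) :
    Tendsto (fun N : ℕ => 2 * ‖CStarMatrix.ofMatrix X.1‖ ^ (N + 1) /
      (1 - ‖CStarMatrix.ofMatrix X.1‖) * C) atTop (𝓝 0) := by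
  have h1 := (tendsto_pow_atTop_nhds_zero_of_lt_one
    (norm_nonneg (CStarMatrix.ofMatrix X.1)) X.2).comp (tendsto_add_atTop_nat 1)
  simpa using! ((h1.const_mul 2).div_const (1 - ‖CStarMatrix.ofMatrix X.1‖)).mul_const C

lemma norm_matForm_gnsHerglotz_sub_le (φ : OperatorState (FreeUnitary B) H) {n : ℕ+}
    (X : MatBall B n) (h k : Fin n → H) (N : ℕ) :
    ‖matForm (gnsHerglotz φ n X) h k - matForm ((cayleySum N (genMul B X.1)).map φ.toFun) h k‖ ≤
    2 * ‖CStarMatrix.ofMatrix X.1‖ ^ (N + 1) / (1 - ‖CStarMatrix.ofMatrix X.1‖) *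
      ∑ i, ∑ j, ‖h j‖ * ‖k i‖ := by
  have h1 := norm_matForm_herglotzTransform_sub_le φ.gnsEmbed φ.gnsRep X h k N
  simp only [OperatorState.compression_gnsEmbed_gnsRep] at h1
  exact h1

/-- The functions `φ ↦ ⟨g_φ(X) h, k⟩` are uniform limits of the functions obtained by truncating
the power series, which involve finitely many matrix coefficients of `φ`. -/
lemma continuous_gnsHerglotz :
    Continuous fun φ : OperatorState (FreeUnitary B) H => gnsHerglotz φ := by
  refine continuous_induced_rng.mpr (continuous_pi fun ⟨n, X, h, k⟩ => ?_)
  refine continuous_of_uniform_approx_of_continuous fun s hs => ?_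
  obtain ⟨ε, hε, hs⟩ := Metric.mem_uniformity_dist.mp hs
  obtain ⟨N, hN⟩ := ((tendsto_truncation_bound X (∑ i, ∑ j, ‖h j‖ * ‖k i‖)).eventually
    (gt_mem_nhds hε)).exists
  refine ⟨fun φ => matForm ((cayleySum N (genMul B X.1)).map φ.toFun) h k, ?_, fun φ => hs ?_⟩
  · exact continuous_finsetSum _ fun i _ => continuous_finsetSum _ fun j _ =>
      OperatorState.continuous_inner_apply _ _ _
  · rw [dist_eq_norm]
    exact (norm_matForm_gnsHerglotz_sub_le φ X h k N).trans_lt hN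

/-- A transform is determined by the moments `V* ρ(·) V`, so it is also the transform of the GNS
representation of its state. -/
lemma gnsHerglotz_stateOfRep {K : Type w} [NormedAddCommGroup K] [InnerProductSpace ℂ K]
    [CompleteSpace K] (V : H →ₗᵢ[ℂ] K) (ρ : FreeUnitary B →⋆ₐ[ℂ] (K →L[ℂ] K)) :
    gnsHerglotz (stateOfRep V ρ) =
      herglotzTransform V (ρ (FreeUnitary.gen B)) (ρ.comp (FreeUnitary.of B)) := by
  funext n X
  refine matForm_injective fun h k => ?_
  have lim {z : ℂ} (hz : ∀ N, ‖z - matForm ((cayleySum N (genMul B X.1)).map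
      (stateOfRep V ρ).toFun) h k‖ ≤ 2 * ‖CStarMatrix.ofMatrix X.1‖ ^ (N + 1) /
        (1 - ‖CStarMatrix.ofMatrix X.1‖) * ∑ i, ∑ j, ‖h j‖ * ‖k i‖) :
      Tendsto (fun N => matForm ((cayleySum N (genMul B X.1)).map (stateOfRep V ρ).toFun) h k)
        atTop (𝓝 z) :=
    tendsto_iff_norm_sub_tendsto_zero.mpr <| squeeze_zero (fun _ => norm_nonneg _)
      (fun N => by rw [norm_sub_rev]; exact hz N) (tendsto_truncation_bound X _)
  exact tendsto_nhds_unique (lim (norm_matForm_gnsHerglotz_sub_le _ X h k))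
    (lim (norm_matForm_herglotzTransform_sub_le V ρ X h k))

lemma range_gnsHerglotz :
    Set.range (fun φ : OperatorState (FreeUnitary B) H => gnsHerglotz φ) =
      representableClass B H := by
  apply Set.Subset.antisymm
  · rintro _ ⟨φ, rfl⟩
    have hU : φ.gnsRep (FreeUnitary.gen B) ∈ unitary (φ.GNS →L[ℂ] φ.GNS) :=
      Unitary.map_mem φ.gnsRep (FreeUnitary.gen_mem_unitary B)
    exact ⟨isRegularHerglotz_herglotzTransform _ hU _,
      φ.GNS, _, _, inferInstance, φ.gnsEmbed, _, _, hU, rfl⟩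
  · rintro _ ⟨-, K, _, _, _, V, U, α, hU, rfl⟩
    refine ⟨stateOfRep V (FreeUnitary.lift α ⟨U, hU⟩), ?_⟩
    change gnsHerglotz _ = _
    rw [gnsHerglotz_stateOfRep, FreeUnitary.lift_gen, FreeUnitary.lift_comp_of]

/-- The numbers `⟨f(X) h, k⟩` separate graded functions. -/
instance : T2Space (GradedFun B H) :=
  T2Space.of_injective_continuous (f := fun (f : GradedFun B H)
      (p : Σ n : ℕ+, MatBall B n × (Fin n → H) × (Fin n → H)) =>
        matForm (f p.1 p.2.1) p.2.2.1 p.2.2.2)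
    (fun f g hfg => by
      funext n X
      exact matForm_injective fun h k => congrFun hfg ⟨n, X, h, k⟩)
    continuous_induced_dom

end Main

end FreeHerglotz

/-- The operator-valued states on the free `*`-algebra generated by `B` and a unitary form a compact
space; `φ ↦ g_φ` is a continuous map from it onto the set of representable regular free Herglotz
functions, which is therefore compact, and closed in the space of all graded functions on the ball,
in the pointwise weak operator topology. -/
theorem mainTheorem4 {B : Type*} [CStarAlgebra B] [PartialOrder B] [StarOrderedRing B]
    {H : Type*} [NormedAddCommGroup H] [InnerProductSpace ℂ H] [CompleteSpace H] :
    CompactSpace (FreeHerglotz.OperatorState (FreeHerglotz.FreeUnitary B) H) ∧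
    Continuous (fun φ : FreeHerglotz.OperatorState (FreeHerglotz.FreeUnitary B) H =>
      FreeHerglotz.gnsHerglotz φ) ∧
    Set.range (fun φ : FreeHerglotz.OperatorState (FreeHerglotz.FreeUnitary B) H =>
      FreeHerglotz.gnsHerglotz φ) = FreeHerglotz.representableClass B H ∧
    IsCompact (FreeHerglotz.representableClass B H) ∧
    IsClosed (FreeHerglotz.representableClass B H) := by
  have hcomp : CompactSpace (FreeHerglotz.OperatorState (FreeHerglotz.FreeUnitary B) H) :=
    FreeHerglotz.OperatorState.compactSpace
  have hcont := FreeHerglotz.continuous_gnsHerglotz (B := B) (H := H)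
  have hrange := FreeHerglotz.range_gnsHerglotz (B := B) (H := H)
  have hcl : IsCompact (FreeHerglotz.representableClass B H) := hrange ▸ isCompact_range hcont
  exact ⟨hcomp, hcont, hrange, hcl, hcl.isClosed⟩
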